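/- Let $G$ be a (finite-dimensional, real) Lie group with Lie algebra $\mathfrak g$, and let $U$ be a strongly continuous unitary representation of $G$ on a separable complex Hilbert space $\mathcal H$. Let $\mathcal D=\mathcal D^\infty(U)$ be the space of smooth vectors, i.e. of those $\varphi\in\mathcal H$ for which $g\mapsto U(g)\varphi$ is a $C^\infty$ map. For $x\in\mathfrak g$ let $dU(x)\varphi=\frac{d}{dt}U(\exp tx)\varphi\big|_{t=0}$, $\varphi\in\mathcal D$, and extend $dU$ to a representation of the complex universal enveloping algebra $\mathcal E(\mathfrak g)$ by linear operators $\mathcal D\to\mathcal D$. Put $\mathcal A=dU(\mathcal E(\mathfrak g))$. Let $\mathcal T_1(\mathcal A)$ be the set of trace class operators $T$ on $\mathcal H$ with $T\mathcal H\subset\mathcal D$, $T^*\mathcal H\subset\mathcal D$ such that $AT$ and $AT^*$ are trace class for all $A\in\mathcal A$. A state is a positive (hence self-adjoint) operator $\rho\in\mathcal T_1(\mathcal A)$ with $\mathrm{Tr}\,\rho=1$; for $A\in\mathcal A$ write $\mathrm{Tr}(\rho A)=\mathrm{Tr}(A\rho)$. The weak topology on the set $\mathcal E_S(\mathcal A)$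 of all states is the coarsest topology for which all the functions $\rho\mapsto\mathrm{Tr}(\rho A)$, $A\in\mathcal A$, are continuous. Let $A\in\mathcal A$ be non-zero and essentially self-adjoint (as an operator in $\mathcal H$ with domain $\mathcal D$). Then: (i) for every state $\rho$ with $\mathrm{Tr}(\rho A)=0$ and every $\varepsilon>0$ there is a state $\sigma$ with $\mathrm{Tr}|\rho-\sigma|<\varepsilon$ and $\mathrm{Tr}(\sigma A)\neq0$; (ii) the set $\{\rho\in\mathcal E_S(\mathcal A):\mathrm{Tr}(\rho A)=0\}$ has empty interior in the weak topology on $\mathcal E_S(\mathcal A)$. -/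

import Mathlib

open scoped Manifold ContDiff Topology
open scoped ENNReal InnerProductSpace TensorProduct
open VectorField Set

/-- The derivative at `x` of a vector valued function `f` on a manifold, along the tangent vector
`v`. -/
noncomputable def dirDeriv {E : Type*} [NormedAddCommGroup E] [NormedSpace ℝ E]
    {M : Type*} [TopologicalSpace M] [ChartedSpace E M]
    {F : Type*} [NormedAddCommGroup F] [NormedSpace ℝ F]
    (f : M → F) (x : M) (v : TangentSpace 𝓘(ℝ, E) x) : F := mfderiv 𝓘(ℝ, E) 𝓘(ℝ, F) f x v

/-- The Lie bracket of vector fields acts on functions as the commutator: `[V, W] f = V (W f) - W (V f)`. -/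
theorem dirDeriv_mlieBracket {E : Type*} [NormedAddCommGroup E] [NormedSpace ℝ E] [CompleteSpace E]
    {M : Type*} [TopologicalSpace M] [ChartedSpace E M] [IsManifold 𝓘(ℝ, E) ∞ M]
    {F : Type*} [NormedAddCommGroup F] [NormedSpace ℝ F]
    (f : M → F) (hf : ContMDiff 𝓘(ℝ, E) 𝓘(ℝ, F) ∞ f)
    (V W : Π x : M, TangentSpace 𝓘(ℝ, E) x) (x : M) (DV DW : M → F)
    (hDV : ∀ y, DV y = dirDeriv f y (V y))
    (hDW : ∀ y, DW y = dirDeriv f y (W y))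
    (sDV : MDifferentiableAt 𝓘(ℝ, E) 𝓘(ℝ, F) DV x)
    (sDW : MDifferentiableAt 𝓘(ℝ, E) 𝓘(ℝ, F) DW x)
    (hV : MDifferentiableAt 𝓘(ℝ, E) (𝓘(ℝ, E).prod 𝓘(ℝ, E)) (fun y => (V y : TangentBundle 𝓘(ℝ, E) M)) x)
    (hW : MDifferentiableAt 𝓘(ℝ, E) (𝓘(ℝ, E).prod 𝓘(ℝ, E)) (fun y => (W y : TangentBundle 𝓘(ℝ, E) M)) x) :
    dirDeriv f x (mlieBracket 𝓘(ℝ, E) V W x) = dirDeriv DW x (V x) - dirDeriv DV x (W x) := by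
  have rg : range 𝓘(ℝ, E) = univ := 𝓘(ℝ, E).range_eq_univ
  let s : E → M := (extChartAt 𝓘(ℝ, E) x).symm
  let u : E := extChartAt 𝓘(ℝ, E) x x
  have su : s u = x := extChartAt_to_inv x
  have htar : (extChartAt 𝓘(ℝ, E) x).target ∈ 𝓝 u := extChartAt_target_mem_nhds x
  have smd : ∀ y ∈ (extChartAt 𝓘(ℝ, E) x).target, MDifferentiableAt 𝓘(ℝ, E) 𝓘(ℝ, E) s y := by
    intro y hy
    have := mdifferentiableWithinAt_extChartAt_symm (I := 𝓘(ℝ, E)) hy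
    rwa [rg, mdifferentiableWithinAt_univ] at this
  have hinv : ∀ y ∈ (extChartAt 𝓘(ℝ, E) x).target, (mfderiv 𝓘(ℝ, E) 𝓘(ℝ, E) s y).IsInvertible := by
    intro y hy
    have := isInvertible_mfderivWithin_extChartAt_symm (I := 𝓘(ℝ, E)) hy
    rwa [rg, mfderivWithin_univ] at this
  have hut := mem_of_mem_nhds htar
  let P : (Π x : M, TangentSpace 𝓘(ℝ, E) x) → E → E := fun Z => mpullback 𝓘(ℝ, E) 𝓘(ℝ, E) s Z
  have key : ∀ (Z : Π x : M, TangentSpace 𝓘(ℝ, E) x) (g : M → F) (y : E),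
      y ∈ (extChartAt 𝓘(ℝ, E) x).target → MDifferentiableAt 𝓘(ℝ, E) 𝓘(ℝ, F) g (s y) →
      fderiv ℝ (g ∘ s) y (P Z y) = dirDeriv g (s y) (Z (s y)) := by
    intro Z g y hy hg
    rw [← mfderiv_eq_fderiv, mfderiv_comp y hg (smd y hy)]
    have h2 : mfderiv 𝓘(ℝ, E) 𝓘(ℝ, E) s y (P Z y) = Z (s y) := by
      obtain ⟨e, he⟩ := hinv y hy
      change mfderiv 𝓘(ℝ, E) 𝓘(ℝ, E) s y ((mfderiv 𝓘(ℝ, E) 𝓘(ℝ, E) s y).inverse (Z (s y))) = _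
      rw [← he, ContinuousLinearMap.inverse_equiv]
      exact e.apply_symm_apply _
    change mfderiv 𝓘(ℝ, E) 𝓘(ℝ, F) g (s y) (mfderiv 𝓘(ℝ, E) 𝓘(ℝ, E) s y (P Z y)) = _
    rw [h2]
    rfl
  have hPd : ∀ Z : Π x : M, TangentSpace 𝓘(ℝ, E) x,
      MDifferentiableAt 𝓘(ℝ, E) (𝓘(ℝ, E).prod 𝓘(ℝ, E)) (fun y => (Z y : TangentBundle 𝓘(ℝ, E) M)) x →
      DifferentiableAt ℝ (P Z) u := by
    intro Z hZ
    have i2 : IsManifold 𝓘(ℝ, E) 2 M := inferInstance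
    have := (MDifferentiableAt.mdifferentiableWithinAt hZ (s := univ)).differentiableWithinAt_mpullbackWithin_vectorField
    rw [rg, preimage_univ, inter_univ, mpullbackWithin_univ] at this
    have h3 : DifferentiableWithinAt ℝ (P Z) univ u := this
    rwa [differentiableWithinAt_univ] at h3
  have hfs : ContDiffAt ℝ ∞ (f ∘ s) u := by
    have h1 : ContMDiffAt 𝓘(ℝ, E) 𝓘(ℝ, E) ∞ s u :=
      (contMDiffOn_extChartAt_symm x).contMDiffAt htar
    exact (hf.contMDiffAt.comp u h1).contDiffAt
  have hd1 : DifferentiableAt ℝ (fderiv ℝ (f ∘ s)) u :=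
    ((hfs.fderiv_right (m := 1) (by norm_cast)).differentiableAt one_ne_zero)
  have hsym : IsSymmSndFDerivAt ℝ (f ∘ s) u :=
    hfs.isSymmSndFDerivAt (by simp only [minSmoothness_of_isRCLikeNormedField]; exact ENat.LEInfty.out)
  have hD : ∀ (Z Y : Π x : M, TangentSpace 𝓘(ℝ, E) x) (DZ : M → F) (hDZ : ∀ y, DZ y = dirDeriv f y (Z y))
      (sDZ : MDifferentiableAt 𝓘(ℝ, E) 𝓘(ℝ, F) DZ x) (hZ : DifferentiableAt ℝ (P Z) u),
      dirDeriv DZ x (Y x) = fderiv ℝ (fderiv ℝ (f ∘ s)) u (P Y u) (P Z u)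
        + fderiv ℝ (f ∘ s) u (fderiv ℝ (P Z) u (P Y u)) := by
    intro Z Y DZ hDZ sDZ hZ
    have e1 : dirDeriv DZ x (Y x) = fderiv ℝ (DZ ∘ s) u (P Y u) := by
      rw [key Y DZ u hut (by rw [su]; exact sDZ), su]
    have e2 : (DZ ∘ s) =ᶠ[𝓝 u] fun y => fderiv ℝ (f ∘ s) y (P Z y) := by
      filter_upwards [htar] with y hy
      rw [key Z f y hy (hf.mdifferentiableAt (by simp)), Function.comp, hDZ]
    rw [e1, e2.fderiv_eq, fderiv_clm_apply hd1 hZ]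
    simp [add_comm]
  have hbr : dirDeriv f x (mlieBracket 𝓘(ℝ, E) V W x) =
      fderiv ℝ (f ∘ s) u (lieBracket ℝ (P V) (P W) u) := by
    have h1 : ContMDiffAt 𝓘(ℝ, E) 𝓘(ℝ, E) ∞ s u :=
      (contMDiffOn_extChartAt_symm x).contMDiffAt htar
    have h2 : P (mlieBracket 𝓘(ℝ, E) V W) u = lieBracket ℝ (P V) (P W) u := by
      have h4 : mpullback 𝓘(ℝ, E) 𝓘(ℝ, E) s (mlieBracket 𝓘(ℝ, E) V W) u =
          mlieBracket 𝓘(ℝ, E) (mpullback 𝓘(ℝ, E) 𝓘(ℝ, E) s V) (mpullback 𝓘(ℝ, E) 𝓘(ℝ, E) s W) u := by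
        have : IsManifold 𝓘(ℝ, E) (minSmoothness ℝ 3) M := by
          simp only [minSmoothness_of_isRCLikeNormedField]; infer_instance
        apply mpullback_mlieBracket (n := ∞) _ _ h1
        · simp only [minSmoothness_of_isRCLikeNormedField]; exact ENat.LEInfty.out
        · rw [su]; exact hV
        · rw [su]; exact hW
      have h5 : mlieBracket 𝓘(ℝ, E) (mpullback 𝓘(ℝ, E) 𝓘(ℝ, E) s V)
          (mpullback 𝓘(ℝ, E) 𝓘(ℝ, E) s W) u = lieBracketWithin ℝ (P V) (P W) univ u :=
        congrFun (mlieBracketWithin_eq_lieBracketWithin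
          (V := mpullback 𝓘(ℝ, E) 𝓘(ℝ, E) s V) (W := mpullback 𝓘(ℝ, E) 𝓘(ℝ, E) s W) (s := univ)) u
      rw [lieBracketWithin_univ] at h5
      exact h4.trans h5
    rw [← h2, key _ f u hut (by rw [su]; exact hf.mdifferentiableAt (by simp)), su]
  rw [hbr, hD W V DW hDW sDW (hPd W hW), hD V W DV hDV sDV (hPd V hV), lieBracket_eq, hsym.eq]
  simp


theorem dirDeriv_clm_comp {E : Type*} [NormedAddCommGroup E] [NormedSpace ℝ E]
    {M : Type*} [TopologicalSpace M] [ChartedSpace E M]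
    {F F' : Type*} [NormedAddCommGroup F] [NormedSpace ℝ F] [NormedAddCommGroup F']
    [NormedSpace ℝ F'] (T : F →L[ℝ] F') (f : M → F) (x : M)
    (hf : MDifferentiableAt 𝓘(ℝ, E) 𝓘(ℝ, F) f x) (v : TangentSpace 𝓘(ℝ, E) x) :
    dirDeriv (fun y => T (f y)) x v = T (dirDeriv f x v) := by
  have h3 : MDifferentiableAt 𝓘(ℝ, F) 𝓘(ℝ, F') (fun y => T y) (f x) :=
    T.differentiableAt.mdifferentiableAt
  have e2 := mfderiv_comp x h3 hf
  have e4 : mfderiv 𝓘(ℝ, F) 𝓘(ℝ, F') (fun y => T y) (f x) = T := by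
    rw [mfderiv_eq_fderiv]
    exact T.fderiv
  rw [e4] at e2
  exact DFunLike.congr_fun e2 v

theorem dirDeriv_add {E : Type*} [NormedAddCommGroup E] [NormedSpace ℝ E]
    {M : Type*} [TopologicalSpace M] [ChartedSpace E M]
    {F : Type*} [NormedAddCommGroup F] [NormedSpace ℝ F] (f g : M → F) (x : M)
    (hf : MDifferentiableAt 𝓘(ℝ, E) 𝓘(ℝ, F) f x) (hg : MDifferentiableAt 𝓘(ℝ, E) 𝓘(ℝ, F) g x)
    (v : TangentSpace 𝓘(ℝ, E) x) :
    dirDeriv (fun y => f y + g y) x v = dirDeriv f x v + dirDeriv g x v :=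
  DFunLike.congr_fun (hf.hasMFDerivAt.add hg.hasMFDerivAt).mfderiv v

instance lEInfty_minSmoothness_three : ENat.LEInfty (minSmoothness ℝ 3) :=
  ⟨by simp only [minSmoothness_of_isRCLikeNormedField]; exact ENat.LEInfty.out⟩

/-- A strongly continuous unitary representation of `G` on the Hilbert space `H`. -/
structure UnitaryRep (G : Type*) [Group G] [TopologicalSpace G]
    (H : Type*) [NormedAddCommGroup H] [InnerProductSpace ℂ H] [CompleteSpace H] where
  toHom : G →* unitary (H →L[ℂ] H)
  continuous_orbit : ∀ φ : H, Continuous fun g => (toHom g : H →L[ℂ] H) φ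

namespace UnitaryRep

variable {E : Type*} [NormedAddCommGroup E] [NormedSpace ℝ E]
  {G : Type*} [Group G] [TopologicalSpace G] [ChartedSpace E G]
  {H : Type*} [NormedAddCommGroup H] [InnerProductSpace ℂ H] [CompleteSpace H]

/-- The unitary operator `U(g)`. -/
noncomputable def op (U : UnitaryRep G H) (g : G) : H →L[ℂ] H := (U.toHom g : H →L[ℂ] H)

theorem op_mul (U : UnitaryRep G H) (g h : G) (φ : H) : U.op (g * h) φ = U.op g (U.op h φ) := by
  simp [op]

theorem op_one (U : UnitaryRep G H) (φ : H) : U.op 1 φ = φ := by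
  simp [op]

variable (E) in
/-- The space of smooth vectors: those `φ` for which `g ↦ U(g) φ` is a `C^∞` map. -/
noncomputable def smoothVectors (U : UnitaryRep G H) : Submodule ℂ H where
  carrier := {φ | ContMDiff 𝓘(ℝ, E) 𝓘(ℝ, H) ∞ fun g => U.op g φ}
  zero_mem' := by simpa using contMDiff_const
  add_mem' := by
    intro a b ha hb
    have e : (fun g => U.op g (a + b)) = (fun g => U.op g a) + fun g => U.op g b := by
      funext g
      simp
    change ContMDiff _ _ _ _
    rw [e]
    exact ContMDiff.add ha hb
  smul_mem' := by
    intro c a ha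
    have h : ContMDiff 𝓘(ℝ, H) 𝓘(ℝ, H) ∞ fun y : H => c • y :=
      (contDiff_const_smul c).contMDiff
    have e : (fun g => U.op g (c • a)) = (fun y : H => c • y) ∘ fun g => U.op g a := by
      funext g
      simp
    change ContMDiff _ _ _ _
    rw [e]
    exact h.comp ha

theorem mdifferentiableAt_orbit (U : UnitaryRep G H) {φ : H} (hφ : φ ∈ U.smoothVectors E) (g : G) :
    MDifferentiableAt 𝓘(ℝ, E) 𝓘(ℝ, H) (fun h => U.op h φ) g :=
  ContMDiff.mdifferentiableAt hφ (by simp)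

theorem dirDeriv_translate (U : UnitaryRep G H) {φ : H} (hφ : φ ∈ U.smoothVectors E) (g : G)
    (x : GroupLieAlgebra 𝓘(ℝ, E) G) :
    dirDeriv (fun h => U.op (g * h) φ) 1 x = U.op g (dirDeriv (fun h => U.op h φ) 1 x) := by
  rw [← ContinuousLinearMap.coe_restrictScalars' (R := ℝ) (f := U.op g),
    ← dirDeriv_clm_comp _ _ _ (U.mdifferentiableAt_orbit hφ 1)]
  simp [op_mul]

variable [LieGroup 𝓘(ℝ, E) ∞ G]

theorem dirDeriv_orbit (U : UnitaryRep G H) {φ : H} (hφ : φ ∈ U.smoothVectors E) (g : G)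
    (x : GroupLieAlgebra 𝓘(ℝ, E) G) :
    U.op g (dirDeriv (fun h => U.op h φ) 1 x)
      = dirDeriv (fun h => U.op h φ) g (mulInvariantVectorField x g) := by
  have h1 : MDifferentiableAt 𝓘(ℝ, E) 𝓘(ℝ, E) (fun h : G => g * h) 1 :=
    (contMDiff_mul_left (I := 𝓘(ℝ, E)) (n := ∞)).mdifferentiableAt (by simp)
  have e1 := DFunLike.congr_fun (mfderiv_comp (1 : G) (U.mdifferentiableAt_orbit hφ (g * 1)) h1) x
  have e2 : dirDeriv (fun h => U.op (g * h) φ) 1 x = dirDeriv (fun h => U.op h φ) (g * 1)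
      (mfderiv 𝓘(ℝ, E) 𝓘(ℝ, E) (fun h : G => g * h) 1 x) := e1
  rw [← U.dirDeriv_translate hφ, e2]
  unfold mulInvariantVectorField
  congr 1
  simp

theorem dirDeriv_mem (U : UnitaryRep G H) {φ : H} (hφ : φ ∈ U.smoothVectors E)
    (x : GroupLieAlgebra 𝓘(ℝ, E) G) :
    dirDeriv (fun h => U.op h φ) 1 x ∈ U.smoothVectors E := by
  let I := 𝓘(ℝ, E)
  let fg : G → TangentBundle I G := fun g => Bundle.TotalSpace.mk' E g 0
  have sfg : ContMDiff I I.tangent ∞ fg := Bundle.contMDiff_zeroSection _ _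
  let fv : G → TangentBundle I G := fun _ => Bundle.TotalSpace.mk' E 1 x
  have sfv : ContMDiff I I.tangent ∞ fv := contMDiff_const
  have S₂ : ContMDiff (I.tangent.prod I.tangent) (I.prod I).tangent ∞
    (equivTangentBundleProd I G I G).symm := contMDiff_equivTangentBundleProd_symm
  let F : G × G → H := fun p => U.op (p.1 * p.2) φ
  have sF : ContMDiff (I.prod I) 𝓘(ℝ, H) ∞ F :=
    ContMDiff.comp (g := fun h => U.op h φ) hφ (contMDiff_mul I ∞)
  have S₃ : ContMDiff (I.prod I).tangent 𝓘(ℝ, H).tangent ∞ (tangentMap (I.prod I) 𝓘(ℝ, H) F) :=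
    sF.contMDiff_tangentMap (m := ∞) le_rfl
  have S₄ := (contMDiff_snd_tangentBundle_modelSpace H 𝓘(ℝ, H)).comp
    ((S₃.comp S₂).comp (sfg.prodMk sfv))
  have e : (fun g => U.op g (dirDeriv (fun h => U.op h φ) 1 x)) = fun g =>
      (tangentMap (I.prod I) 𝓘(ℝ, H) F ((equivTangentBundleProd I G I G).symm (fg g, fv g))).2 := by
    funext g
    have h := mfderiv_prod_eq_add_apply (I := I) (I' := I) (f := F) (p := (g, (1 : G)))
      (v := ((0 : E), (x : E))) (sF.mdifferentiableAt (by simp))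
    have h0 : mfderiv I 𝓘(ℝ, H) (fun z : G => F (z, 1)) g (0 : TangentSpace I g) = 0 := map_zero _
    refine Eq.trans ?_ h.symm
    refine Eq.trans ?_ (congrArg (fun a : H => a + dirDeriv (fun z : G => F (g, z)) 1 x) h0.symm)
    rw [← U.dirDeriv_translate hφ]
    exact (zero_add _).symm
  change ContMDiff _ _ _ _
  rw [e]
  exact S₄

/-- The infinitesimal generator `dU(x)` of a Lie algebra element `x`, on the smooth vectors: the
derivative at the identity, in the direction `x`, of `g ↦ U(g) φ`. -/
noncomputable def dU (U : UnitaryRep G H) (x : GroupLieAlgebra 𝓘(ℝ, E) G) :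
    Module.End ℂ (U.smoothVectors E) where
  toFun φ := ⟨dirDeriv (fun g => U.op g φ) 1 x, U.dirDeriv_mem φ.2 x⟩
  map_add' φ ψ := by
    ext
    simpa using dirDeriv_add _ _ _ (U.mdifferentiableAt_orbit φ.2 1)
      (U.mdifferentiableAt_orbit ψ.2 1) x
  map_smul' c φ := by
    ext
    simpa using dirDeriv_clm_comp ((c • ContinuousLinearMap.id ℂ H).restrictScalars ℝ) _ _
      (U.mdifferentiableAt_orbit φ.2 1) x

/-- `dU(x) φ` is the derivative at `t = 0` of `U(exp(t x)) φ`: the curve `γ(t) = exp(t x)` is the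
integral curve, starting at the identity, of the left invariant vector field defined by `x`. -/
theorem hasDerivAt_dU (U : UnitaryRep G H) (x : GroupLieAlgebra 𝓘(ℝ, E) G)
    (γ : ℝ → G) (h0 : γ 0 = 1)
    (hγ : IsMIntegralCurve (I := 𝓘(ℝ, E)) γ (mulInvariantVectorField x))
    (φ : U.smoothVectors E) :
    HasDerivAt (fun t => U.op (γ t) φ) (U.dU x φ : H) 0 := by
  have h1 := (U.mdifferentiableAt_orbit φ.2 (γ 0)).hasMFDerivAt.comp 0 (hγ 0)
  let L : ℝ →L[ℝ] H := (mfderiv 𝓘(ℝ, E) 𝓘(ℝ, H) (fun h => U.op h (φ : H)) (γ 0)).comp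
    ((1 : ℝ →L[ℝ] ℝ).smulRight (mulInvariantVectorField x (γ 0)))
  have h2 : HasFDerivAt (fun t => U.op (γ t) (φ : H)) L 0 := hasMFDerivAt_iff_hasFDerivAt.1 h1
  have h3 : L 1 = dirDeriv (fun h => U.op h (φ : H)) (γ 0) (mulInvariantVectorField x (γ 0)) := by
    change mfderiv 𝓘(ℝ, E) 𝓘(ℝ, H) (fun h => U.op h (φ : H)) (γ 0)
      ((1 : ℝ) • mulInvariantVectorField x (γ 0)) = _
    rw [one_smul]
    rfl
  have h4 : L 1 = (U.dU x φ : H) := by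
    rw [h3, h0, ← U.dirDeriv_orbit φ.2, op_one]
    rfl
  rw [← h4]
  exact h2.hasDerivAt

variable [CompleteSpace E]

attribute [local instance 100] LieRing.ofAssociativeRing

/-- `dU` is a representation of the Lie algebra of `G` on the smooth vectors. -/
noncomputable def dULie (U : UnitaryRep G H) :
    GroupLieAlgebra 𝓘(ℝ, E) G →ₗ⁅ℝ⁆ Module.End ℂ (U.smoothVectors E) where
  toFun := U.dU
  map_add' x y := by
    ext φ
    exact map_add (mfderiv 𝓘(ℝ, E) 𝓘(ℝ, H) (fun g => U.op g φ) (1 : G)) x y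
  map_smul' r x := by
    ext φ
    exact map_smul (mfderiv 𝓘(ℝ, E) 𝓘(ℝ, H) (fun g => U.op g φ) (1 : G)) r x
  map_lie' := by
    intro x y
    ext φ
    have := dirDeriv_mlieBracket (fun g => U.op g φ) φ.2 (mulInvariantVectorField x)
      (mulInvariantVectorField y) 1 (fun g => U.op g (U.dU x φ)) (fun g => U.op g (U.dU y φ))
      (fun g => U.dirDeriv_orbit φ.2 g x) (fun g => U.dirDeriv_orbit φ.2 g y)
      (U.mdifferentiableAt_orbit (U.dU x φ).2 1) (U.mdifferentiableAt_orbit (U.dU y φ).2 1)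
      (mdifferentiableAt_mulInvariantVectorField x) (mdifferentiableAt_mulInvariantVectorField y)
    rw [← U.dirDeriv_orbit (U.dU x φ).2, ← U.dirDeriv_orbit (U.dU y φ).2,
      op_one, op_one] at this
    exact this

/-- The infinitesimal representation of the (complex) universal enveloping algebra on the smooth
vectors: the unique homomorphism of unital complex algebras that extends `x ↦ dU(x)`. -/
noncomputable def infinitesimalRep (U : UnitaryRep G H) :
    ℂ ⊗[ℝ] UniversalEnvelopingAlgebra ℝ (GroupLieAlgebra 𝓘(ℝ, E) G) →ₐ[ℂ]
      Module.End ℂ (U.smoothVectors E) :=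
  Algebra.TensorProduct.lift (Algebra.ofId ℂ _)
    (UniversalEnvelopingAlgebra.lift ℝ U.dULie) fun c _ => Algebra.commutes c _

variable (E) in
/-- The algebra `dU(𝓔(𝔤))` of operators on the smooth vectors: the image of the enveloping algebra
under the infinitesimal representation. -/
noncomputable def opAlgebra (U : UnitaryRep G H) :
    Subalgebra ℂ (Module.End ℂ (U.smoothVectors E)) :=
  U.infinitesimalRep.range

end UnitaryRep

section States

variable {H : Type*} [NormedAddCommGroup H] [InnerProductSpace ℂ H] [CompleteSpace H]

variable (H) in
/-- The index set of a Hilbert basis of `H`, chosen once and for all. -/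
noncomputable def traceIndex : Set H := (exists_hilbertBasis ℂ H).choose

variable (H) in
/-- A Hilbert basis of `H`, chosen once and for all; traces are computed in it. For trace class
operators, and for positive ones, the trace does not depend on the basis. -/
noncomputable def traceBasis : HilbertBasis (traceIndex H) ℂ H :=
  (exists_hilbertBasis ℂ H).choose_spec.choose

/-- The trace norm `Tr |T|` of a bounded operator, where `|T| = √(T* T)`; it may be infinite. -/
noncomputable def traceNorm (T : H →L[ℂ] H) : ℝ≥0∞ :=
  ∑' i, ENNReal.ofReal (RCLike.re ⟪traceBasis H i, CFC.abs T (traceBasis H i)⟫_ℂ)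

/-- A bounded operator is trace class if `Tr |T| < ∞`. -/
def IsTraceClass (T : H →L[ℂ] H) : Prop := traceNorm T < ⊤

/-- The trace of an everywhere defined operator (meaningful for trace class operators). -/
noncomputable def opTrace (T : H →ₗ[ℂ] H) : ℂ :=
  ∑' i, ⟪traceBasis H i, T (traceBasis H i)⟫_ℂ

variable {D : Submodule ℂ H}

/-- The everywhere defined operator `A T`, for `A : D → D` and `T : H → H` with range in `D`. -/
def opComp (A : Module.End ℂ D) (T : H →L[ℂ] H) (hT : ∀ x, T x ∈ D) : H →ₗ[ℂ] H :=
  D.subtype ∘ₗ A ∘ₗ (T : H →ₗ[ℂ] H).codRestrict D hT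

/-- An operator on `D`, viewed as an unbounded operator on `H` with domain `D`, is essentially
self-adjoint if its closure is self-adjoint. -/
def IsEssentiallySelfAdjoint (A : Module.End ℂ D) : Prop :=
  IsSelfAdjoint (LinearPMap.mk D (D.subtype ∘ₗ A)).closure

/-- The class `𝒯₁(𝒜)` of an algebra `𝒜` of operators on `D`: the trace class operators `T` such that
`T` and `T*` map `H` into `D` and `A T`, `A T*` are (bounded and) trace class for all `A ∈ 𝒜`. -/
structure MemTraceClassOf (𝒜 : Subalgebra ℂ (Module.End ℂ D)) (T : H →L[ℂ] H) : Prop where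
  isTraceClass : IsTraceClass T
  maps : ∀ x, T x ∈ D
  maps_adjoint : ∀ x, ContinuousLinearMap.adjoint T x ∈ D
  comp : ∀ A ∈ 𝒜, ∃ S : H →L[ℂ] H, (S : H →ₗ[ℂ] H) = opComp A T maps ∧ IsTraceClass S
  comp_adjoint : ∀ A ∈ 𝒜, ∃ S : H →L[ℂ] H,
    (S : H →ₗ[ℂ] H) = opComp A (ContinuousLinearMap.adjoint T) maps_adjoint ∧ IsTraceClass S

/-- The states on `𝒜`: the positive (in particular self-adjoint) operators of trace one
in `𝒯₁(𝒜)`. -/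
structure DensityState (𝒜 : Subalgebra ℂ (Module.End ℂ D)) where
  op : H →L[ℂ] H
  mem : MemTraceClassOf 𝒜 op
  isPositive : op.IsPositive
  trace_eq_one : opTrace (op : H →ₗ[ℂ] H) = 1

/-- The expectation value `Tr (ρ A) = Tr (A ρ)`. -/
noncomputable def DensityState.expect {𝒜 : Subalgebra ℂ (Module.End ℂ D)} (ρ : DensityState 𝒜)
    (A : Module.End ℂ D) : ℂ :=
  opTrace (opComp A ρ.op ρ.mem.maps)

/-- The weak topology on the state space: the coarsest topology for which all the functions
`ρ ↦ Tr (ρ A)`, `A ∈ 𝒜`, are continuous. -/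
noncomputable instance DensityState.weakTopology (𝒜 : Subalgebra ℂ (Module.End ℂ D)) :
    TopologicalSpace (DensityState 𝒜) :=
  ⨅ A : 𝒜, TopologicalSpace.induced (fun ρ : DensityState 𝒜 => ρ.expect (A : Module.End ℂ D))
    inferInstance

end States

/-! One state that sees `A` is enough: mixing a little of it into any other state makes the
expectation of `A` nonzero. A nonzero symmetric operator has some `φ` in its domain with `⟪A φ, φ⟫ ≠
0`, so the vector state `σ` of the normalized `φ` has `σ(A) ≠ 0` (`exists_expect_ne_zero`). If `ρ(A)
= 0`, then `(1 - t) ρ + t σ` has expectation `t σ(A)`, which vanishes only at `t = 0`. Its trace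
distance to `ρ` is `t Tr|ρ - σ|`, hence arbitrarily small, which gives (i). The segment is also
weakly continuous in `t`, so a weak interior point of the zero set would force a whole interval of
zeros, which gives (ii).

The remaining work is to show that states form a convex set on which expectations are affine. This
needs trace class operators to be closed under linear combinations, with additive traces. Both
follow from a variational description of the trace norm: `Tr|T|` is the largest value of `∑ |⟪e i, W
T e i⟫|` over contractions `W`. Polar decomposition enters only through Douglas' lemma. -/

section TraceClass

/-! ### Trace norm and trace class operators -/

variable {H : Type*} [NormedAddCommGroup H] [InnerProductSpace ℂ H]

/-- Parseval's identity with values in `ℝ≥0∞`. -/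
theorem HilbertBasis.tsum_enorm_inner_sq {ι : Type*} (b : HilbertBasis ι ℂ H) (x : H) :
    ∑' i, ‖⟪b i, x⟫_ℂ‖ₑ ^ 2 = ‖x‖ₑ ^ 2 := by
  have h := (b.hasSum_inner_mul_inner x x).mapL Complex.reCLM
  have h1 : ∀ i, Complex.reCLM (⟪x, b i⟫_ℂ * ⟪b i, x⟫_ℂ) = ‖⟪b i, x⟫_ℂ‖ ^ 2 := by
    intro i
    rw [← inner_conj_symm x (b i), Complex.conj_mul']
    norm_cast
  have h2 : Complex.reCLM ⟪x, x⟫_ℂ = ‖x‖ ^ 2 := by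
    rw [inner_self_eq_norm_sq_to_K]
    norm_cast
  simp only [h1, h2] at h
  have h3 := ENNReal.ofReal_tsum_of_nonneg (fun i => sq_nonneg ‖⟪b i, x⟫_ℂ‖) h.summable
  rw [h.tsum_eq] at h3
  simpa [ENNReal.ofReal_pow] using h3.symm

theorem ContinuousLinearMap.enorm_apply_le_of_norm_le_one {V : H →L[ℂ] H} (hV : ‖V‖ ≤ 1) (x : H) :
    ‖V x‖ₑ ≤ ‖x‖ₑ :=
  enorm_le_iff_norm_le.2 (by simpa using V.le_of_opNorm_le hV x)

theorem enorm_inner_le_half (x y : H) :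
    ‖⟪x, y⟫_ℂ‖ₑ ≤ 2⁻¹ * (‖x‖ₑ ^ 2 + ‖y‖ₑ ^ 2) := by
  have h : ‖⟪x, y⟫_ℂ‖ ≤ 2⁻¹ * (‖x‖ ^ 2 + ‖y‖ ^ 2) := by
    nlinarith [norm_inner_le_norm (𝕜 := ℂ) x y, sq_nonneg (‖x‖ - ‖y‖)]
  have h' := ENNReal.ofReal_le_ofReal h
  rw [ENNReal.ofReal_mul (by norm_num), ENNReal.ofReal_add (by positivity) (by positivity),
    ENNReal.ofReal_pow (norm_nonneg _), ENNReal.ofReal_pow (norm_nonneg _),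
    ENNReal.ofReal_inv_of_pos two_pos] at h'
  simpa using h'

variable [CompleteSpace H]

/-- Douglas' lemma: a bounded operator that is dominated by another one factors through it, by a
contraction. -/
theorem exists_contraction_comp_eq (S T : H →L[ℂ] H) (h : ∀ x, ‖S x‖ ≤ ‖T x‖) :
    ∃ V : H →L[ℂ] H, ‖V‖ ≤ 1 ∧ V ∘L T = S := by
  let K : Submodule ℂ H := T.range.topologicalClosure
  have hK : ∀ x, T x ∈ K := fun x => T.range.le_topologicalClosure ⟨x, rfl⟩
  let e : H →ₗ[ℂ] K := (T : H →ₗ[ℂ] H).codRestrict K hK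
  have : CompleteSpace K := T.range.isClosed_topologicalClosure.completeSpace_coe
  have he : DenseRange e := by
    intro y
    rw [closure_subtype]
    have hy : (y : H) ∈ closure (T.range : Set H) := y.2
    convert hy using 2
    ext z
    constructor
    · rintro ⟨_, ⟨x, rfl⟩, rfl⟩
      exact ⟨x, rfl⟩
    · rintro ⟨x, rfl⟩
      exact ⟨e x, ⟨x, rfl⟩, rfl⟩
  have hb : ∀ x, ‖(S : H →ₗ[ℂ] H) x‖ ≤ 1 * ‖e x‖ := fun x => by
    rw [one_mul]
    exact h x
  -- `V` sends `T x` to `S x`, extends by continuity to the closure `K` of the range of `T`, and is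
  -- zero on the orthogonal complement of `K`.
  refine ⟨((S : H →ₗ[ℂ] H).extendOfNorm e) ∘L K.orthogonalProjectionOnto, ?_, ?_⟩
  · refine (ContinuousLinearMap.opNorm_comp_le _ _).trans ?_
    exact mul_le_one₀ (LinearMap.opNorm_extendOfNorm_le he zero_le_one hb) (norm_nonneg _)
      K.orthogonalProjectionOnto_norm_le
  · ext x
    have h1 : K.orthogonalProjectionOnto (T x) = e x :=
      K.orthogonalProjectionOnto_mem_subspace_eq_self (e x)
    simp [h1, LinearMap.extendOfNorm_eq he ⟨1, hb⟩]

/-- Since `|T|² = T* T`, the operators `T` and `|T|` dominate each other, so Douglas' lemma factors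
each through the other. -/
theorem norm_cfcAbs_apply (T : H →L[ℂ] H) (x : H) : ‖CFC.abs T x‖ = ‖T x‖ := by
  have h1 : ContinuousLinearMap.adjoint (CFC.abs T) = CFC.abs T :=
    (IsSelfAdjoint.of_nonneg (CFC.abs_nonneg T)).adjoint_eq
  have h2 : ContinuousLinearMap.adjoint (CFC.abs T) ∘L CFC.abs T
      = ContinuousLinearMap.adjoint T ∘L T := by
    rw [h1]
    exact CFC.abs_mul_abs T
  rw [← sq_eq_sq₀ (norm_nonneg _) (norm_nonneg _),
    ContinuousLinearMap.apply_norm_sq_eq_inner_adjoint_left,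
    ContinuousLinearMap.apply_norm_sq_eq_inner_adjoint_left]
  exact congrArg (fun A : H →L[ℂ] H => RCLike.re ⟪A x, x⟫_ℂ) h2

/-- The Hilbert-Schmidt norms of an operator and of its adjoint agree. -/
theorem HilbertBasis.tsum_enorm_adjoint_sq {ι : Type*} (b : HilbertBasis ι ℂ H) (T : H →L[ℂ] H) :
    ∑' i, ‖ContinuousLinearMap.adjoint T (b i)‖ₑ ^ 2 = ∑' i, ‖T (b i)‖ₑ ^ 2 := by
  -- Both sides are the sum of the squared matrix entries of `T`, taken in opposite orders.
  simp_rw [← b.tsum_enorm_inner_sq]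
  rw [ENNReal.tsum_comm]
  refine tsum_congr fun i => tsum_congr fun j => ?_
  rw [ContinuousLinearMap.adjoint_inner_right, ← inner_conj_symm, RCLike.enorm_conj]

/-- `√|T|` is self-adjoint with square `|T|`, so the trace norm of `T` is a squared Hilbert-Schmidt
norm. -/
theorem traceNorm_eq_tsum_sqrt (T : H →L[ℂ] H) :
    traceNorm T = ∑' i, ‖CFC.sqrt (CFC.abs T) (traceBasis H i)‖ₑ ^ 2 := by
  have h1 : ContinuousLinearMap.adjoint (CFC.sqrt (CFC.abs T)) = CFC.sqrt (CFC.abs T) :=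
    (IsSelfAdjoint.of_nonneg (CFC.sqrt_nonneg (CFC.abs T))).adjoint_eq
  have h2 : CFC.sqrt (CFC.abs T) ∘L CFC.sqrt (CFC.abs T) = CFC.abs T :=
    CFC.sqrt_mul_sqrt_self _ (CFC.abs_nonneg T)
  refine tsum_congr fun i => ?_
  rw [← ofReal_norm, ← ENNReal.ofReal_pow (norm_nonneg _),
    ContinuousLinearMap.apply_norm_sq_eq_inner_adjoint_right, h1, h2]

/-- Write `T = V C C` with `C = √|T|` and `V` a contraction. Each term pairs `(W V C)* e i` with `C
e i`. By the inequality between arithmetic and geometric means, half the sum of two squared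
Hilbert-Schmidt norms bounds the series, and neither exceeds `Tr|T|`. -/
theorem tsum_enorm_inner_le_traceNorm (T W : H →L[ℂ] H) (hW : ‖W‖ ≤ 1) :
    ∑' i, ‖⟪traceBasis H i, W (T (traceBasis H i))⟫_ℂ‖ₑ ≤ traceNorm T := by
  set C := CFC.sqrt (CFC.abs T)
  have h1 : ContinuousLinearMap.adjoint C = C :=
    (IsSelfAdjoint.of_nonneg (CFC.sqrt_nonneg (CFC.abs T))).adjoint_eq
  have h2 : C ∘L C = CFC.abs T := CFC.sqrt_mul_sqrt_self _ (CFC.abs_nonneg T)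
  obtain ⟨V, hV, hVT⟩ := exists_contraction_comp_eq T (CFC.abs T)
    fun x => (norm_cfcAbs_apply T x).ge
  have hT : ∀ x, T x = V (C (C x)) := fun x => by
    rw [← ContinuousLinearMap.comp_apply C C, h2, ← ContinuousLinearMap.comp_apply, hVT]
  have hWV : ‖W ∘L V‖ ≤ 1 :=
    (ContinuousLinearMap.opNorm_comp_le _ _).trans (mul_le_one₀ hW (norm_nonneg _) hV)
  have h3 : ∑' i, ‖ContinuousLinearMap.adjoint (W ∘L V ∘L C) (traceBasis H i)‖ₑ ^ 2
      ≤ traceNorm T := by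
    rw [HilbertBasis.tsum_enorm_adjoint_sq, traceNorm_eq_tsum_sqrt]
    refine ENNReal.tsum_le_tsum fun i => pow_le_pow_left' ?_ 2
    exact ContinuousLinearMap.enorm_apply_le_of_norm_le_one hWV _
  calc ∑' i, ‖⟪traceBasis H i, W (T (traceBasis H i))⟫_ℂ‖ₑ
      ≤ ∑' i, 2⁻¹ * (‖ContinuousLinearMap.adjoint (W ∘L V ∘L C) (traceBasis H i)‖ₑ ^ 2
          + ‖C (traceBasis H i)‖ₑ ^ 2) := by
        refine ENNReal.tsum_le_tsum fun i => ?_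
        refine le_trans (le_of_eq ?_) (enorm_inner_le_half _ _)
        rw [ContinuousLinearMap.adjoint_inner_left, hT]
        rfl
    _ ≤ 2⁻¹ * (traceNorm T + traceNorm T) := by
        rw [ENNReal.tsum_mul_left, ENNReal.tsum_add]
        gcongr
        exact (traceNorm_eq_tsum_sqrt T).ge
    _ = traceNorm T := by
        rw [← two_mul, ← mul_assoc, ENNReal.inv_mul_cancel two_ne_zero ENNReal.ofNat_ne_top,
          one_mul]

/-- The contraction with `W T = |T|` attains the bound of `tsum_enorm_inner_le_traceNorm`. -/
theorem exists_traceNorm_le_tsum (T : H →L[ℂ] H) :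
    ∃ W : H →L[ℂ] H, ‖W‖ ≤ 1 ∧
      traceNorm T ≤ ∑' i, ‖⟪traceBasis H i, W (T (traceBasis H i))⟫_ℂ‖ₑ := by
  obtain ⟨W, hW, hWT⟩ := exists_contraction_comp_eq (CFC.abs T) T
    fun x => (norm_cfcAbs_apply T x).le
  refine ⟨W, hW, ENNReal.tsum_le_tsum fun i => ?_⟩
  rw [← ContinuousLinearMap.comp_apply W T, hWT, ← ofReal_norm]
  exact ENNReal.ofReal_le_ofReal (RCLike.re_le_norm _)

/-- The triangle inequality for the trace norm. -/
theorem traceNorm_add_le (S T : H →L[ℂ] H) : traceNorm (S + T) ≤ traceNorm S + traceNorm T := by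
  -- The contraction that is optimal for `S + T` is an admissible competitor for `S` and for `T`.
  obtain ⟨W, hW, h⟩ := exists_traceNorm_le_tsum (S + T)
  refine h.trans ((ENNReal.tsum_le_tsum fun i => ?_).trans (ENNReal.tsum_add.le.trans
    (add_le_add (tsum_enorm_inner_le_traceNorm S W hW) (tsum_enorm_inner_le_traceNorm T W hW))))
  rw [add_apply, map_add, inner_add_right]
  exact enorm_add_le _ _

theorem traceNorm_smul (c : ℂ) (T : H →L[ℂ] H) : traceNorm (c • T) = ‖c‖ₑ * traceNorm T := by
  rw [traceNorm, traceNorm, ← ENNReal.tsum_mul_left]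
  refine tsum_congr fun i => ?_
  rw [CFC.abs_smul, ← ofReal_norm, ← ENNReal.ofReal_mul (norm_nonneg _)]
  simp

theorem IsTraceClass.add {S T : H →L[ℂ] H} (hS : IsTraceClass S) (hT : IsTraceClass T) :
    IsTraceClass (S + T) :=
  (traceNorm_add_le S T).trans_lt (ENNReal.add_lt_top.2 ⟨hS, hT⟩)

theorem IsTraceClass.smul (c : ℂ) {T : H →L[ℂ] H} (hT : IsTraceClass T) :
    IsTraceClass (c • T) := by
  rw [IsTraceClass, traceNorm_smul]
  exact ENNReal.mul_lt_top enorm_lt_top hT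

theorem IsTraceClass.summable {T : H →L[ℂ] H} (hT : IsTraceClass T) :
    Summable fun i => ⟪traceBasis H i, T (traceBasis H i)⟫_ℂ := by
  have h := tsum_enorm_inner_le_traceNorm T (.id ℂ H) ContinuousLinearMap.norm_id_le
  exact .of_norm (tsum_enorm_ne_top_iff_summable_norm.1 (h.trans_lt hT).ne)

/-- Each diagonal term is a product of a coefficient of `W x` and one of `y`. As `a b ≤ a² + b²`,
Parseval bounds the sum. -/
theorem isTraceClass_rankOne (x y : H) : IsTraceClass (InnerProductSpace.rankOne ℂ x y) := by
  obtain ⟨W, -, h⟩ := exists_traceNorm_le_tsum (InnerProductSpace.rankOne ℂ x y)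
  have h1 : ∀ i, ‖⟪traceBasis H i, W (InnerProductSpace.rankOne ℂ x y (traceBasis H i))⟫_ℂ‖ₑ
      ≤ ‖⟪traceBasis H i, W x⟫_ℂ‖ₑ ^ 2 + ‖⟪traceBasis H i, y⟫_ℂ‖ₑ ^ 2 := by
    intro i
    rw [InnerProductSpace.rankOne_apply, map_smul, inner_smul_right, enorm_mul,
      ← inner_conj_symm, RCLike.enorm_conj]
    set a := ‖⟪traceBasis H i, y⟫_ℂ‖ₑ
    set b := ‖⟪traceBasis H i, W x⟫_ℂ‖ₑ
    rcases le_total a b with hab | hab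
    · exact le_add_right (by rw [sq]; gcongr)
    · exact le_add_left (by rw [sq]; gcongr)
  refine h.trans_lt ((ENNReal.tsum_le_tsum h1).trans_lt ?_)
  rw [ENNReal.tsum_add, HilbertBasis.tsum_enorm_inner_sq, HilbertBasis.tsum_enorm_inner_sq]
  exact ENNReal.add_lt_top.2 ⟨ENNReal.pow_lt_top enorm_lt_top, ENNReal.pow_lt_top enorm_lt_top⟩

theorem opTrace_add {S T : H →L[ℂ] H} (hS : IsTraceClass S) (hT : IsTraceClass T) :
    opTrace ((S + T : H →L[ℂ] H) : H →ₗ[ℂ] H)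
      = opTrace (S : H →ₗ[ℂ] H) + opTrace (T : H →ₗ[ℂ] H) := by
  simp only [opTrace, ← hS.summable.tsum_add hT.summable, ContinuousLinearMap.coe_coe,
    add_apply, inner_add_right]

theorem opTrace_smul (c : ℂ) (T : H →ₗ[ℂ] H) : opTrace (c • T) = c * opTrace T := by
  simp only [opTrace, ← tsum_mul_left, LinearMap.smul_apply, inner_smul_right]

theorem opTrace_rankOne (x y : H) :
    opTrace (InnerProductSpace.rankOne ℂ x y : H →ₗ[ℂ] H) = ⟪y, x⟫_ℂ := by
  rw [opTrace, ← (traceBasis H).tsum_inner_mul_inner y x]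
  exact tsum_congr fun i => by simp

end TraceClass

/-! ### Operators in `𝒯₁(𝒜)` and convex combinations of states -/

section States

variable {H : Type*} [NormedAddCommGroup H] [InnerProductSpace ℂ H]
  {D : Submodule ℂ H} {𝒜 : Subalgebra ℂ (Module.End ℂ D)}

theorem opComp_apply (A : Module.End ℂ D) (T : H →L[ℂ] H) (hT : ∀ x, T x ∈ D) (x : H) :
    opComp A T hT x = A ⟨T x, hT x⟩ := rfl

theorem opComp_add (A : Module.End ℂ D) (S T : H →L[ℂ] H) (hS : ∀ x, S x ∈ D)
    (hT : ∀ x, T x ∈ D) (hST : ∀ x, (S + T) x ∈ D) :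
    opComp A (S + T) hST = opComp A S hS + opComp A T hT := by
  ext x
  rw [LinearMap.add_apply, opComp_apply, opComp_apply, opComp_apply, ← Submodule.coe_add,
    ← map_add]
  rfl

theorem opComp_smul (A : Module.End ℂ D) (c : ℂ) (T : H →L[ℂ] H) (hT : ∀ x, T x ∈ D)
    (hcT : ∀ x, (c • T) x ∈ D) :
    opComp A (c • T) hcT = c • opComp A T hT := by
  ext x
  rw [LinearMap.smul_apply, opComp_apply, opComp_apply, ← Submodule.coe_smul, ← map_smul]
  rfl

theorem opComp_rankOne (A : Module.End ℂ D) (φ : D) (ψ : H)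
    (h : ∀ x, InnerProductSpace.rankOne ℂ (φ : H) ψ x ∈ D) :
    opComp A (InnerProductSpace.rankOne ℂ (φ : H) ψ) h
      = InnerProductSpace.rankOne ℂ (A φ : H) ψ := by
  ext x
  have h1 : (⟨InnerProductSpace.rankOne ℂ (φ : H) ψ x, h x⟩ : D) = ⟪ψ, x⟫_ℂ • φ := rfl
  rw [opComp_apply, h1, map_smul]
  rfl

variable [CompleteSpace H]

/-- To be in `𝒯₁(𝒜)`, a self-adjoint operator only has to satisfy the conditions that do not
involve its adjoint. -/
theorem MemTraceClassOf.of_isSelfAdjoint {T : H →L[ℂ] H} (hsa : IsSelfAdjoint T)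
    (hT : IsTraceClass T) (maps : ∀ x, T x ∈ D)
    (comp : ∀ A ∈ 𝒜, ∃ S : H →L[ℂ] H, (S : H →ₗ[ℂ] H) = opComp A T maps ∧ IsTraceClass S) :
    MemTraceClassOf 𝒜 T := by
  have e : ContinuousLinearMap.adjoint T = T := hsa.adjoint_eq
  refine ⟨hT, maps, by rwa [e], comp, ?_⟩
  simp only [e]
  exact comp

/-- The convex combination `(1 - t) ρ + t σ` of two states. -/
noncomputable def DensityState.mix (ρ σ : DensityState 𝒜) (t : unitInterval) :
    DensityState 𝒜 where
  op := ((1 - t : ℝ) : ℂ) • ρ.op + ((t : ℝ) : ℂ) • σ.op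
  mem := by
    refine MemTraceClassOf.of_isSelfAdjoint ?_ ((ρ.mem.isTraceClass.smul _).add
      (σ.mem.isTraceClass.smul _)) (fun x => ?_) fun A hA => ?_
    · exact .add (.smul (Complex.conj_ofReal _) ρ.isPositive.isSelfAdjoint)
        (.smul (Complex.conj_ofReal _) σ.isPositive.isSelfAdjoint)
    · exact D.add_mem (D.smul_mem _ (ρ.mem.maps x)) (D.smul_mem _ (σ.mem.maps x))
    · obtain ⟨R, hR, hR'⟩ := ρ.mem.comp A hA
      obtain ⟨S, hS, hS'⟩ := σ.mem.comp A hA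
      refine ⟨((1 - t : ℝ) : ℂ) • R + ((t : ℝ) : ℂ) • S, ?_, (hR'.smul _).add (hS'.smul _)⟩
      rw [opComp_add A _ _ (fun x => D.smul_mem _ (ρ.mem.maps x))
          (fun x => D.smul_mem _ (σ.mem.maps x)),
        opComp_smul A _ _ ρ.mem.maps, opComp_smul A _ _ σ.mem.maps, ← hR, ← hS]
      rfl
  isPositive := by
    refine .add (.smul_of_nonneg ρ.isPositive ?_) (.smul_of_nonneg σ.isPositive ?_)
    · exact_mod_cast sub_nonneg.2 t.2.2
    · exact_mod_cast t.2.1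
  trace_eq_one := by
    rw [opTrace_add (ρ.mem.isTraceClass.smul _) (σ.mem.isTraceClass.smul _),
      ContinuousLinearMap.toLinearMap_smul, ContinuousLinearMap.toLinearMap_smul, opTrace_smul, opTrace_smul,
      ρ.trace_eq_one, σ.trace_eq_one]
    push_cast
    ring

/-- Membership `A ∈ 𝒜` makes `A ρ` and `A σ` trace class, so that their trace series converge and
can be added. -/
theorem DensityState.expect_mix (ρ σ : DensityState 𝒜) (t : unitInterval)
    {A : Module.End ℂ D} (hA : A ∈ 𝒜) :
    (ρ.mix σ t).expect A = ((1 - t : ℝ) : ℂ) * ρ.expect A + ((t : ℝ) : ℂ) * σ.expect A := by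
  obtain ⟨R, hR, hR'⟩ := ρ.mem.comp A hA
  obtain ⟨S, hS, hS'⟩ := σ.mem.comp A hA
  have h : opComp A (ρ.mix σ t).op (ρ.mix σ t).mem.maps
      = ((((1 - t : ℝ) : ℂ) • R + ((t : ℝ) : ℂ) • S : H →L[ℂ] H) : H →ₗ[ℂ] H) := by
    refine (opComp_add A _ _ (fun x => D.smul_mem _ (ρ.mem.maps x))
      (fun x => D.smul_mem _ (σ.mem.maps x)) _).trans ?_
    rw [opComp_smul A _ _ ρ.mem.maps, opComp_smul A _ _ σ.mem.maps, ← hR, ← hS]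
    rfl
  rw [expect, h, opTrace_add (hR'.smul _) (hS'.smul _), ContinuousLinearMap.toLinearMap_smul,
    ContinuousLinearMap.toLinearMap_smul, opTrace_smul, opTrace_smul, hR, hS, expect, expect]

/-- The weak topology is initial for the expectations, and these are affine in `t` along the
segment. -/
theorem DensityState.continuous_mix (ρ σ : DensityState 𝒜) : Continuous (ρ.mix σ) := by
  refine continuous_iInf_rng.2 fun A => continuous_induced_rng.2 ?_
  have h : (fun τ : DensityState 𝒜 => τ.expect (A : Module.End ℂ D)) ∘ ρ.mix σ = fun t : unitInterval =>
      ((1 - t : ℝ) : ℂ) * ρ.expect A + ((t : ℝ) : ℂ) * σ.expect A :=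
    funext fun t => ρ.expect_mix σ t A.2
  rw [h]
  fun_prop

theorem DensityState.mix_zero (ρ σ : DensityState 𝒜) : ρ.mix σ 0 = ρ := by
  cases ρ
  simp [mix]

theorem DensityState.sub_mix_op (ρ σ : DensityState 𝒜) (t : unitInterval) :
    ρ.op - (ρ.mix σ t).op = ((t : ℝ) : ℂ) • (ρ.op - σ.op) := by
  simp only [mix]
  push_cast
  module

theorem DensityState.traceNorm_sub_lt_top (ρ σ : DensityState 𝒜) :
    traceNorm (ρ.op - σ.op) < ⊤ := by
  rw [sub_eq_add_neg, ← neg_one_smul ℂ σ.op]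
  exact ρ.mem.isTraceClass.add (σ.mem.isTraceClass.smul _)

/-! ### Vector states and a state detecting `A` -/

variable (𝒜) in
/-- The vector state of a unit vector in the domain. -/
noncomputable def DensityState.ofVector (ψ : D) (hψ : ‖ψ‖ = 1) : DensityState 𝒜 where
  op := InnerProductSpace.rankOne ℂ (ψ : H) (ψ : H)
  mem := .of_isSelfAdjoint
    (InnerProductSpace.isStarProjection_rankOne_self (x := (ψ : H)) hψ).isSelfAdjoint
    (isTraceClass_rankOne _ _) (fun _ => D.smul_mem _ ψ.2)
    fun A _ => ⟨InnerProductSpace.rankOne ℂ (A ψ : H) (ψ : H), (opComp_rankOne A ψ _ _).symm,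
      isTraceClass_rankOne _ _⟩
  isPositive := InnerProductSpace.isPositive_rankOne_self (ψ : H)
  trace_eq_one := by
    rw [opTrace_rankOne, inner_self_eq_norm_sq_to_K, Submodule.norm_coe, hψ]
    simp

theorem DensityState.expect_ofVector (ψ : D) (hψ : ‖ψ‖ = 1) (A : Module.End ℂ D) :
    (ofVector 𝒜 ψ hψ).expect A = ⟪ψ, A ψ⟫_ℂ :=
  (congrArg opTrace (opComp_rankOne A ψ _ _)).trans (opTrace_rankOne _ _)

/-- The closure extends `A` and, being its own adjoint, is formally adjoint to itself. Density of
its domain is read off from self-adjointness, so no separate density theorem for `D` is required. -/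
theorem IsEssentiallySelfAdjoint.isSymmetric {A : Module.End ℂ D}
    (hA : IsEssentiallySelfAdjoint A) : A.IsSymmetric := by
  intro x y
  set B := LinearPMap.mk D (D.subtype ∘ₗ A)
  have h := LinearPMap.adjoint_isFormalAdjoint hA.dense_domain
  rw [LinearPMap.isSelfAdjoint_def.1 hA] at h
  have hc := B.le_closure
  have hx := hc.2 (x := x) (y := ⟨x, hc.1 x.2⟩) rfl
  have hy := hc.2 (x := y) (y := ⟨y, hc.1 y.2⟩) rfl
  have hxy := h ⟨x, hc.1 x.2⟩ ⟨y, hc.1 y.2⟩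
  rw [← hx, ← hy] at hxy
  exact hxy

/-- A nonzero essentially self-adjoint operator has a nonzero expectation value in some state. -/
theorem DensityState.exists_expect_ne_zero {A : Module.End ℂ D}
    (hA : IsEssentiallySelfAdjoint A) (hne : A ≠ 0) :
    ∃ σ : DensityState 𝒜, σ.expect A ≠ 0 := by
  -- A symmetric operator whose quadratic form vanishes is zero, by polarization.
  obtain ⟨φ, hφ⟩ : ∃ φ, ⟪A φ, φ⟫_ℂ ≠ 0 := by
    by_contra! h
    exact hne (hA.isSymmetric.inner_map_self_eq_zero.1 h)
  have h0 : φ ≠ 0 := by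
    rintro rfl
    simp at hφ
  refine ⟨ofVector 𝒜 (((‖φ‖⁻¹ : ℝ) : ℂ) • φ) ?_, ?_⟩
  · rw [norm_smul, Complex.norm_real, norm_inv, norm_norm,
      inv_mul_cancel₀ (norm_ne_zero_iff.2 h0)]
  · rw [expect_ofVector, ← hA.isSymmetric, map_smul, inner_smul_left, inner_smul_right]
    refine mul_ne_zero ?_ (mul_ne_zero ?_ hφ) <;> simp [h0]

end States

/-! ### Perturbing a state along a segment -/

theorem proposition10 {n : ℕ}
    {G : Type*} [Group G] [TopologicalSpace G] [ChartedSpace (EuclideanSpace ℝ (Fin n)) G]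
    [LieGroup 𝓘(ℝ, EuclideanSpace ℝ (Fin n)) ∞ G]
    {H : Type*} [NormedAddCommGroup H] [InnerProductSpace ℂ H] [CompleteSpace H]
    [TopologicalSpace.SeparableSpace H]
    (U : UnitaryRep G H)
    (A : Module.End ℂ (U.smoothVectors (EuclideanSpace ℝ (Fin n))))
    (hA : A ∈ U.opAlgebra (EuclideanSpace ℝ (Fin n)))
    (hsa : IsEssentiallySelfAdjoint A) (hne : A ≠ 0) :
    (∀ ρ : DensityState (U.opAlgebra (EuclideanSpace ℝ (Fin n))), ρ.expect A = 0 →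
      ∀ ε : ℝ, 0 < ε → ∃ σ : DensityState (U.opAlgebra (EuclideanSpace ℝ (Fin n))),
        traceNorm (ρ.op - σ.op) < ENNReal.ofReal ε ∧ σ.expect A ≠ 0) ∧
    interior {ρ : DensityState (U.opAlgebra (EuclideanSpace ℝ (Fin n))) | ρ.expect A = 0} = ∅ := by
  obtain ⟨σ, hσ⟩ := DensityState.exists_expect_ne_zero
    (𝒜 := U.opAlgebra (EuclideanSpace ℝ (Fin n))) hsa hne
  -- On the segment from `ρ` to `σ` the expectation is `t σ(A)`.
  have hmix : ∀ ρ : DensityState (U.opAlgebra (EuclideanSpace ℝ (Fin n))), ρ.expect A = 0 →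
      ∀ t : unitInterval, (ρ.mix σ t).expect A = 0 → (t : ℝ) = 0 := by
    intro ρ hρ t ht
    rw [ρ.expect_mix σ t hA, hρ, mul_zero, zero_add] at ht
    exact_mod_cast (mul_eq_zero.1 ht).resolve_right hσ
  constructor
  · intro ρ hρ ε hε
    have hM := (ρ.traceNorm_sub_lt_top σ).ne
    set M := (traceNorm (ρ.op - σ.op)).toReal
    have hM0 : 0 ≤ M := ENNReal.toReal_nonneg
    -- This value of `t` lies in `(0, 1]` and satisfies `t M < ε`, including when `M = 0`.
    have ht0 : 0 < ε / (ε + M + 1) := by positivity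
    have ht1 : ε / (ε + M + 1) ≤ 1 := (div_le_one (by positivity)).2 (by linarith)
    refine ⟨ρ.mix σ ⟨_, ht0.le, ht1⟩, ?_, fun h => ht0.ne' (hmix ρ hρ _ h)⟩
    rw [ρ.sub_mix_op, traceNorm_smul, ← ENNReal.ofReal_toReal hM, ← ofReal_norm,
      ← ENNReal.ofReal_mul (norm_nonneg _), Complex.norm_of_nonneg ht0.le]
    refine (ENNReal.ofReal_lt_ofReal_iff hε).2 ?_
    rw [div_mul_eq_mul_div, div_lt_iff₀ (by positivity)]
    exact mul_lt_mul_of_pos_left (by linarith) hε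
  · refine eq_empty_of_forall_notMem fun ρ hρ => ?_
    have hρ0 : ρ.expect A = 0 := by
      simpa using interior_subset hρ
    have hev : ∀ᶠ t in 𝓝 (0 : unitInterval), (ρ.mix σ t).expect A = 0 := by
      have h := (ρ.continuous_mix σ).tendsto 0
      rw [ρ.mix_zero] at h
      exact h (mem_interior_iff_mem_nhds.1 hρ)
    have hev' : ∀ᶠ t in 𝓝 (0 : unitInterval), t = 0 :=
      hev.mono fun t ht => Subtype.ext (hmix ρ hρ0 t ht)
    -- Contradiction: `0` is not isolated in the unit interval.
    obtain ⟨t, ht, ht'⟩ := ((hev'.filter_mono nhdsWithin_le_nhds).and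
      (eventually_mem_nhdsWithin (s := {0}ᶜ))).exists
    exact ht' ht
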